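/- Let $\pi(z_1,z_2)=(z_1+z_2,z_1z_2)$, $\mathbb G_2=\pi(\mathbb D^2)$, $\Gamma=\pi(\overline{\mathbb D}^2)$ and $b\Gamma=\pi(\mathbb T^2)$. A commuting pair $(S,P)$ of bounded operators on a complex Hilbert space is a *$\Gamma$-contraction* if its Taylor joint spectrum lies in $\Gamma$ and $\|f(S,P)\|\le\sup_{\Gamma}|f|$ for every rational function $f=p/q$ with $p,q\in\mathbb C[z_1,z_2]$ and $q$ without zeros in $\Gamma$; it is *pure* if moreover $P^{*n}\to 0$ strongly as $n\to\infty$. A polynomial $f\in\mathbb C[z_1,z_2]$ with zero set $Z(f)$ is *$\Gamma$-distinguished* if $Z(f)\cap\mathbb G_2\neq\emptyset$ and $Z(f)\cap\partial\Gamma=Z(f)\cap b\Gamma$; a $\Gamma$-contraction is *$\Gamma$-distinguished* if $f(S,P)=0$ for some $\Gamma$-distinguished polynomial $f$. For a contraction $P$ put $D_P=(I-P^*P)^{1/2}$ and $\mathcal D_P=\overline{\operatorname{Ran}}\,D_P$. The *fundamental operator* of a $\Gamma$-contraction $(S,P)$ is the unique $A\in\mathcal B(\mathcal D_P)$ with $S-S^*P=D_PAD_P$.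 Let $r$ denote the spectral radius. Theorem. Let $(S,P)$ be a pure $\Gamma$-contraction on a complex Hilbert space $\mathcal H$ such that $\dim\mathcal D_{P^*}<\infty$, and let $F_*\in\mathcal B(\mathcal D_{P^*})$ be the fundamental operator of $(S^*,P^*)$. Then $(F_*,0)$ is $\Gamma$-distinguished if and only if $r(F_*)<1$; and if $(F_*,0)$ is $\Gamma$-distinguished or $r(F_*)<1$, then $(S,P)$ is $\Gamma$-distinguished. -/

import Mathlib

open scoped Topology

noncomputable section

namespace SymBidisc

/-- The symmetrization map `π(z₁, z₂) = (z₁ + z₂, z₁ z₂)`. -/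
def symmetrization (z : ℂ × ℂ) : ℂ × ℂ := (z.1 + z.2, z.1 * z.2)

/-- The open symmetrized bidisc `𝔾₂ = π(𝔻²)`. -/
def openSymBidisc : Set (ℂ × ℂ) :=
  symmetrization '' {z | ‖z.1‖ < 1 ∧ ‖z.2‖ < 1}

/-- The closed symmetrized bidisc `Γ`, the image under `π` of the closed bidisc. -/
def Gam : Set (ℂ × ℂ) :=
  symmetrization '' {z | ‖z.1‖ ≤ 1 ∧ ‖z.2‖ ≤ 1}

/-- The distinguished boundary `bΓ = π(𝕋²)`. -/
def distinguishedBoundary : Set (ℂ × ℂ) :=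
  symmetrization '' {z | ‖z.1‖ = 1 ∧ ‖z.2‖ = 1}

/-- The value of a polynomial of `ℂ[z₁, z₂]` at a point of `ℂ²`. -/
def polyVal (f : MvPolynomial (Fin 2) ℂ) (z : ℂ × ℂ) : ℂ :=
  MvPolynomial.eval ![z.1, z.2] f

/-- The zero set `Z(f)` in `ℂ²`. -/
def zeroSet (f : MvPolynomial (Fin 2) ℂ) : Set (ℂ × ℂ) := {z | polyVal f z = 0}

/-- `f` is `Γ`-distinguished: `Z(f) ∩ 𝔾₂ ≠ ∅` and `Z(f) ∩ ∂Γ = Z(f) ∩ bΓ`, where `∂Γ` is the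
topological boundary of `Γ` in `ℂ²`. -/
def IsGammaDistinguishedPoly (f : MvPolynomial (Fin 2) ℂ) : Prop :=
  (zeroSet f ∩ openSymBidisc).Nonempty ∧
    zeroSet f ∩ frontier Gam = zeroSet f ∩ distinguishedBoundary

section Operators

variable {H : Type*} [NormedAddCommGroup H] [InnerProductSpace ℂ H]

/-- `f(S, P) = ∑ c_{ij} Sⁱ Pʲ` for `f = ∑ c_{ij} z₁ⁱ z₂ʲ` and a (commuting) pair `(S, P)`. -/
def polyCalc (S P : H →L[ℂ] H) (f : MvPolynomial (Fin 2) ℂ) : H →L[ℂ] H :=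
  ∑ m ∈ f.support, f.coeff m • (S ^ m 0 * P ^ m 1)

/-- Exactness of the Koszul complex `0 → H → H ⊕ H → H → 0` of a commuting pair `(A, B)`, whose
maps are `x ↦ (A x, B x)` and `(x, y) ↦ A y - B x`. -/
def KoszulExact (A B : H →L[ℂ] H) : Prop :=
  (∀ x, A x = 0 → B x = 0 → x = 0) ∧
  (∀ x y, A y - B x = 0 → ∃ z, A z = x ∧ B z = y) ∧
  (∀ w, ∃ x y, A y - B x = w)

/-- The Taylor joint spectrum of a commuting pair. -/
def taylorSpectrum (S P : H →L[ℂ] H) : Set (ℂ × ℂ) :=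
  {l | ¬ KoszulExact (S - l.1 • (1 : H →L[ℂ] H)) (P - l.2 • (1 : H →L[ℂ] H))}

/-- A commuting pair `(S, P)` is a `Γ`-contraction if `Γ` is a spectral set for it: the Taylor
joint spectrum lies in `Γ` and `‖f(S, P)‖ ≤ sup_Γ |f|` for every rational function `f = p / q`
such that `q` has no zero in `Γ`. Here `f(S, P) = p(S, P) q(S, P)⁻¹`; by the spectral mapping
theorem `q(S, P)` is invertible as soon as the Taylor joint spectrum lies in `Γ`. -/
structure IsGammaContraction (S P : H →L[ℂ] H) : Prop where
  commute : Commute S P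
  taylorSpectrum_subset : taylorSpectrum S P ⊆ Gam
  vonNeumann : ∀ p q : MvPolynomial (Fin 2) ℂ, (∀ z ∈ Gam, polyVal q z ≠ 0) →
    ‖polyCalc S P p * Ring.inverse (polyCalc S P q)‖ ≤
      sSup ((fun z => ‖polyVal p z / polyVal q z‖) '' Gam)

/-- A `Γ`-contraction is `Γ`-distinguished if some `Γ`-distinguished polynomial annihilates it. -/
def IsGammaDistinguished (S P : H →L[ℂ] H) : Prop :=
  IsGammaContraction S P ∧ ∃ f, IsGammaDistinguishedPoly f ∧ polyCalc S P f = 0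

variable [CompleteSpace H]

/-- A `Γ`-contraction `(S, P)` is pure if `P*ⁿ → 0` strongly. -/
def IsPureGammaContraction (S P : H →L[ℂ] H) : Prop :=
  IsGammaContraction S P ∧
    ∀ x : H, Filter.Tendsto (fun n : ℕ => (ContinuousLinearMap.adjoint P ^ n) x)
      Filter.atTop (𝓝 0)

/-- The defect operator `D_P = (I - P* P)^{1/2}` of a contraction `P`. -/
def defectOp (P : H →L[ℂ] H) : H →L[ℂ] H :=
  CFC.sqrt (1 - ContinuousLinearMap.adjoint P * P)

/-- The defect space `𝒟_P`, the closure of the range of `D_P`. -/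
def defectSpace (P : H →L[ℂ] H) : Submodule ℂ H :=
  (defectOp P).range.topologicalClosure

instance defectSpace_completeSpace (P : H →L[ℂ] H) : CompleteSpace (defectSpace P) :=
  (Submodule.isClosed_topologicalClosure _).completeSpace_coe

theorem defectOp_mem (P : H →L[ℂ] H) (x : H) : defectOp P x ∈ defectSpace P :=
  Submodule.le_topologicalClosure _ ⟨x, rfl⟩

/-- `A ∈ B(𝒟_P)` is the fundamental operator of `(S, P)`: it solves `S - S* P = D_P A D_P`.
As `D_P` maps onto a dense subspace of `𝒟_P` and is injective on `𝒟_P`, there is at most one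
such `A`. -/
def IsFundamentalOperator (S P : H →L[ℂ] H) (A : defectSpace P →L[ℂ] defectSpace P) : Prop :=
  ∀ x : H, S x - ContinuousLinearMap.adjoint S (P x) =
    defectOp P (A ⟨defectOp P x, defectOp_mem P x⟩ : H)

end Operators

end SymBidisc

end

/-!
Write `E = 𝒟_{P*}` and `D = D_{P*}`, regarded as a map into `E`.

**Numerical radius.** The function `(2 α z₂ - z₁) / (2 - α z₁)` is bounded by `1` on `Γ` when
`‖α‖ < 1`. Its von Neumann inequality, passed to adjoints and to the limit `‖α‖ → 1`, gives
`Re (α ⟪y, F y⟫) ≤ ‖y‖ ^ 2` on the range of `D`, so the numerical radius of `F` is at most `1`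
(`IsFundamentalOperator.norm_inner_le`).

**`(F, 0)` is a `Γ`-contraction.** If `v` is a unit eigenvector of `F + z F*`, its eigenvalue is
`a + z * conj a` with `a = ⟪v, F v⟫`, and `(a + conj a * z, z)` lies in `Γ` for `‖a‖, ‖z‖ ≤ 1`. For
`‖z‖ = 1` the operator `F + z F*` is normal, so `p / q` evaluated at `(F + z F*, z)` has norm at most
`sup_Γ |p / q|`. The maximum modulus principle in `z` transfers this bound to `(F, 0)`
(`isGammaContraction_zero`).

**A distinguished polynomial.** Let `g = det (F + z₂ F* - z₁)`. A zero of `g` has the form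
`(a + conj a * p, p)` as above, and it is interior to `Γ` if `‖a‖, ‖p‖ < 1`. If `‖a‖ = 1` and
`‖p‖ < 1`, equality in the numerical radius bound makes `a` an eigenvalue of `F`, which
`r(F) < 1` excludes. Hence `z₁ g` is `Γ`-distinguished (`isGammaDistinguishedPoly_X_mul`).
Conversely, an eigenvalue `l` of `F` with `‖l‖ = 1` puts the point `(l, 0)` of `∂Γ \ bΓ` on the zero
set of every polynomial annihilating `(F, 0)` (`norm_lt_one_of_isGammaDistinguished`).

**Annihilation.** By Cayley–Hamilton `g(F, 0) = 0`. For `(S, P)`, the relation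
`D S* = F D + F* D P*` (`IsFundamentalOperator.defectMap_apply`) and the adjugate of the pencil give
`D g(S*, P*) = 0` (`comp_polyCalc_pencilPoly`). Since `P*` commutes with `g(S*, P*)` and
`‖D x‖ ^ 2 = ‖x‖ ^ 2 - ‖P* x‖ ^ 2`, the powers of `P*` preserve the norm on the range of
`g(S*, P*)`; purity forces this range to be `0`. The polynomial for `(S, P)` is `z₁` times the
coefficientwise conjugate of `g`.
-/

noncomputable section

namespace SymBidisc

open ComplexConjugate ContinuousLinearMap

/-! ### Geometry of the symmetrized bidisc -/

theorem isCompact_Gam : IsCompact Gam := by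
  have h : {z : ℂ × ℂ | ‖z.1‖ ≤ 1 ∧ ‖z.2‖ ≤ 1} =
      Metric.closedBall (0 : ℂ) 1 ×ˢ Metric.closedBall (0 : ℂ) 1 := by
    ext z; simp
  unfold Gam
  rw [h]
  refine ((isCompact_closedBall _ _).prod (isCompact_closedBall _ _)).image ?_
  unfold symmetrization
  fun_prop

theorem norm_fst_le_of_mem_Gam {z : ℂ × ℂ} (hz : z ∈ Gam) : ‖z.1‖ ≤ 2 := by
  obtain ⟨w, ⟨h1, h2⟩, rfl⟩ := hz
  exact (norm_add_le _ _).trans (by linarith)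

theorem norm_snd_le_of_mem_Gam {z : ℂ × ℂ} (hz : z ∈ Gam) : ‖z.2‖ ≤ 1 := by
  obtain ⟨w, ⟨h1, h2⟩, rfl⟩ := hz
  simpa [symmetrization] using mul_le_one₀ h1 (norm_nonneg _) h2

/-- The two sides are `‖z - β‖ ^ 2` and `‖1 - conj β * z‖ ^ 2`; their difference is
`(‖z‖ ^ 2 - 1) * (1 - ‖β‖ ^ 2)`, so outside the disc the first dominates, and the equation
`z * (z - β) = p * (conj β * z - 1)` has no root there. -/
theorem norm_root_le_one {β p z : ℂ} (hβ : ‖β‖ ≤ 1) (hp : ‖p‖ ≤ 1)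
    (hz : z * z - (β + conj β * p) * z + p = 0) : ‖z‖ ≤ 1 := by
  by_contra! hlt
  have hfac : z * (z - β) = p * (conj β * z - 1) := by linear_combination hz
  have hnorm : ‖z‖ ^ 2 * ‖z - β‖ ^ 2 = ‖p‖ ^ 2 * ‖conj β * z - 1‖ ^ 2 := by
    rw [← mul_pow, ← mul_pow, ← norm_mul, ← norm_mul, hfac]
  have hdiff : ‖z - β‖ ^ 2 - ‖conj β * z - 1‖ ^ 2 = (‖z‖ ^ 2 - 1) * (1 - ‖β‖ ^ 2) := by
    simp only [Complex.sq_norm, Complex.normSq_apply, Complex.sub_re, Complex.sub_im,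
      Complex.mul_re, Complex.mul_im, Complex.conj_re, Complex.conj_im, Complex.one_re,
      Complex.one_im]
    ring
  have hz2 : 0 < ‖z‖ ^ 2 - 1 := by nlinarith
  have hβ2 : 0 ≤ 1 - ‖β‖ ^ 2 := by nlinarith [norm_nonneg β]
  have hp2 : ‖p‖ ^ 2 ≤ 1 := by nlinarith [norm_nonneg p]
  have hM : ‖p‖ ^ 2 * ‖conj β * z - 1‖ ^ 2 ≤ ‖conj β * z - 1‖ ^ 2 :=
    mul_le_of_le_one_left (sq_nonneg _) hp2
  have hN : (‖z‖ ^ 2 - 1) * ‖z - β‖ ^ 2 ≤ 0 := by nlinarith [mul_nonneg hz2.le hβ2]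
  have hzero : ‖z - β‖ ^ 2 ≤ 0 := nonpos_of_mul_nonpos_right hN hz2
  have : z - β = 0 := by simpa using le_antisymm hzero (sq_nonneg _)
  rw [sub_eq_zero.1 this] at hlt
  exact absurd hβ (not_le.2 hlt)

theorem mem_Gam_of_norm_le {β p : ℂ} (hβ : ‖β‖ ≤ 1) (hp : ‖p‖ ≤ 1) :
    (β + conj β * p, p) ∈ Gam := by
  set s := β + conj β * p with hs
  obtain ⟨d, hd⟩ := IsAlgClosed.exists_pow_nat_eq (s ^ 2 - 4 * p) (n := 2) two_pos
  refine ⟨((s + d) / 2, (s - d) / 2),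
    ⟨norm_root_le_one hβ hp ?_, norm_root_le_one hβ hp ?_⟩, Prod.ext ?_ ?_⟩
  · linear_combination hd / 4
  · linear_combination hd / 4
  · simp only [symmetrization]; ring
  · simp only [symmetrization]; linear_combination - hd / 4

theorem mem_interior_Gam {β p : ℂ} (hβ : ‖β‖ < 1) (hp : ‖p‖ < 1) :
    (β + conj β * p, p) ∈ interior Gam := by
  -- On `‖p‖ < 1` the parameter is recovered as `β = (s - conj s * p) / (1 - ‖p‖ ^ 2)`.
  have hopen : IsOpen {w : ℂ × ℂ | ‖w.1 - conj w.1 * w.2‖ < 1 - ‖w.2‖ ^ 2} :=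
    isOpen_lt (by fun_prop) (by fun_prop)
  have key (w : ℂ) : conj w * w = ((‖w‖ ^ 2 : ℝ) : ℂ) := by
    rw [mul_comm, Complex.mul_conj, Complex.normSq_eq_norm_sq]
  refine mem_interior.2 ⟨_, ?_, hopen, ?_⟩
  · rintro ⟨s, q⟩ (hw : ‖s - conj s * q‖ < 1 - ‖q‖ ^ 2)
    have hq : 0 < 1 - ‖q‖ ^ 2 := (norm_nonneg _).trans_lt hw
    have hq1 : ‖q‖ ≤ 1 := by nlinarith [norm_nonneg q]
    have hc : ((1 - ‖q‖ ^ 2 : ℝ) : ℂ) ≠ 0 := by exact_mod_cast hq.ne'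
    have hb : ‖(s - conj s * q) / ((1 - ‖q‖ ^ 2 : ℝ) : ℂ)‖ ≤ 1 := by
      rw [norm_div, Complex.norm_real, Real.norm_of_nonneg hq.le, div_le_one hq]
      exact hw.le
    have := mem_Gam_of_norm_le hb hq1
    convert this using 2
    rw [map_div₀, Complex.conj_ofReal, div_mul_eq_mul_div, ← add_div, eq_div_iff hc]
    simp only [map_sub, map_mul, Complex.conj_conj, Complex.ofReal_sub, Complex.ofReal_one, ← key]
    ring
  · have hp2 : 0 < 1 - ‖p‖ ^ 2 := by nlinarith [norm_nonneg p]
    have : β + conj β * p - conj (β + conj β * p) * p = β * ((1 - ‖p‖ ^ 2 : ℝ) : ℂ) := by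
      simp only [map_add, map_mul, Complex.conj_conj, Complex.ofReal_sub, Complex.ofReal_one,
        ← key]
      ring
    change ‖β + conj β * p - conj (β + conj β * p) * p‖ < 1 - ‖p‖ ^ 2
    rw [this, norm_mul, Complex.norm_real, Real.norm_of_nonneg hp2.le]
    exact mul_lt_of_lt_one_left hp2 hβ

theorem mem_distinguishedBoundary_of_norm_snd_eq_one {z : ℂ × ℂ} (hz : z ∈ Gam)
    (h : ‖z.2‖ = 1) : z ∈ distinguishedBoundary := by
  obtain ⟨w, ⟨h1, h2⟩, rfl⟩ := hz
  have h' : ‖w.1‖ * ‖w.2‖ = 1 := by simpa [symmetrization] using h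
  exact ⟨w, ⟨by nlinarith [norm_nonneg w.1, norm_nonneg w.2],
    by nlinarith [norm_nonneg w.1, norm_nonneg w.2]⟩, rfl⟩

theorem norm_snd_of_mem_distinguishedBoundary {z : ℂ × ℂ} (hz : z ∈ distinguishedBoundary) :
    ‖z.2‖ = 1 := by
  obtain ⟨w, ⟨h1, h2⟩, rfl⟩ := hz
  simp [symmetrization, h1, h2]

theorem mem_frontier_of_smul_not_mem {z w : ℂ × ℂ} (hz : z ∈ Gam)
    (h : ∀ t : ℝ, 0 < t → z + (t : ℂ) • w ∉ Gam) : z ∈ frontier Gam := by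
  rw [isCompact_Gam.isClosed.frontier_eq]
  refine ⟨hz, fun hint => ?_⟩
  have hcont : Filter.Tendsto (fun t : ℝ => z + (t : ℂ) • w) (𝓝[>] 0) (𝓝 z) := by
    have : Continuous (fun t : ℝ => z + (t : ℂ) • w) := by fun_prop
    simpa using (this.tendsto 0).mono_left nhdsWithin_le_nhds
  obtain ⟨t, ht, ht0⟩ := ((hcont.eventually (mem_interior_iff_mem_nhds.1 hint)).and
    self_mem_nhdsWithin).exists
  exact h t ht0 ht

theorem distinguishedBoundary_subset_frontier : distinguishedBoundary ⊆ frontier Gam := by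
  intro z hz
  have h1 := norm_snd_of_mem_distinguishedBoundary hz
  have hG : z ∈ Gam := by
    obtain ⟨w, ⟨hw1, hw2⟩, rfl⟩ := hz
    exact ⟨w, ⟨hw1.le, hw2.le⟩, rfl⟩
  refine mem_frontier_of_smul_not_mem (w := (0, z.2)) hG fun t ht hmem => ?_
  have := norm_snd_le_of_mem_Gam hmem
  have h2 : (z + (t : ℂ) • ((0 : ℂ), z.2)).2 = ((1 + t : ℝ) : ℂ) * z.2 := by
    simp; ring
  rw [h2, norm_mul, h1, Complex.norm_real, Real.norm_of_nonneg (by linarith)] at this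
  linarith

theorem mk_zero_mem_Gam {a : ℂ} (ha : ‖a‖ ≤ 1) : (a, (0 : ℂ)) ∈ Gam :=
  ⟨(a, 0), ⟨ha, by simp⟩, by simp [symmetrization]⟩

theorem mk_zero_mem_Gam_iff {a : ℂ} : (a, (0 : ℂ)) ∈ Gam ↔ ‖a‖ ≤ 1 := by
  refine ⟨?_, mk_zero_mem_Gam⟩
  rintro ⟨w, ⟨h1, h2⟩, h⟩
  simp only [symmetrization, Prod.mk.injEq, mul_eq_zero] at h
  rcases h with ⟨rfl, h | h⟩ <;> simpa [h]

theorem mk_zero_mem_frontier {a : ℂ} (ha : ‖a‖ = 1) : (a, (0 : ℂ)) ∈ frontier Gam := by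
  refine mem_frontier_of_smul_not_mem (w := (a, 0)) (mk_zero_mem_Gam ha.le) fun t ht hmem => ?_
  have h2 : ((a, (0 : ℂ)) + (t : ℂ) • (a, (0 : ℂ))) = (((1 + t : ℝ) : ℂ) * a, 0) := by
    simp; ring
  rw [h2, mk_zero_mem_Gam_iff, norm_mul, ha, Complex.norm_real,
    Real.norm_of_nonneg (by linarith)] at hmem
  linarith

theorem bddAbove_rational_image {p q : MvPolynomial (Fin 2) ℂ} (hq : ∀ z ∈ Gam, polyVal q z ≠ 0) :
    BddAbove ((fun z => ‖polyVal p z / polyVal q z‖) '' Gam) := by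
  have hcont (f : MvPolynomial (Fin 2) ℂ) : Continuous (polyVal f) := by
    refine (MvPolynomial.continuous_eval f).comp (continuous_pi fun i => ?_)
    fin_cases i
    · exact continuous_fst
    · exact continuous_snd
  exact (isCompact_Gam.image_of_continuousOn
    (((hcont p).continuousOn.div (hcont q).continuousOn hq).norm)).bddAbove

theorem isGammaDistinguishedPoly_of {f : MvPolynomial (Fin 2) ℂ}
    (h0 : (zeroSet f ∩ openSymBidisc).Nonempty)
    (h : ∀ z ∈ zeroSet f, z ∈ frontier Gam → ‖z.2‖ = 1) : IsGammaDistinguishedPoly f := by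
  refine ⟨h0, Set.Subset.antisymm (fun z hz => ⟨hz.1, ?_⟩)
    (fun z hz => ⟨hz.1, distinguishedBoundary_subset_frontier hz.2⟩)⟩
  exact mem_distinguishedBoundary_of_norm_snd_eq_one
    (isCompact_Gam.isClosed.frontier_subset hz.2) (h z hz.1 hz.2)

/-- With `X = 1 / (1 - α z₁)` and `Y = 1 / (1 - α z₂)` the claim reads
`‖X + Y - 2‖ ≤ ‖α‖ * ‖X + Y‖`. Both points lie in the disc `‖X - 1‖ ≤ ‖α‖ * ‖X‖`, which is
convex, so their midpoint does too. -/
theorem norm_two_mul_sub_le {α : ℂ} (hα : ‖α‖ < 1) (hα0 : α ≠ 0) {z : ℂ × ℂ} (hz : z ∈ Gam) :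
    ‖2 * α * z.2 - z.1‖ ≤ ‖2 - α * z.1‖ := by
  have disc (u : ℂ) (hu : ‖u‖ ≤ 1) : ∃ X : ℂ, X ≠ 0 ∧ (1 - α * u) * X = 1 ∧
      (1 - ‖α‖ ^ 2) * (X.re ^ 2 + X.im ^ 2) - 2 * X.re + 1 ≤ 0 := by
    have hlt : ‖α * u‖ < 1 := by
      rw [norm_mul]; exact (mul_le_of_le_one_right (norm_nonneg _) hu).trans_lt hα
    have hne : 1 - α * u ≠ 0 := by
      intro h
      rw [← sub_eq_zero.1 h] at hlt
      simp at hlt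
    refine ⟨(1 - α * u)⁻¹, inv_ne_zero hne, mul_inv_cancel₀ hne, ?_⟩
    set X := (1 - α * u)⁻¹
    have hX : X - 1 = α * u * X := by
      have : (1 - α * u) * X = 1 := mul_inv_cancel₀ hne
      linear_combination this
    have hle : ‖X - 1‖ ^ 2 ≤ ‖α‖ ^ 2 * ‖X‖ ^ 2 := by
      rw [hX, norm_mul, norm_mul, mul_pow, mul_pow, mul_assoc]
      refine mul_le_mul_of_nonneg_left ?_ (sq_nonneg _)
      exact mul_le_of_le_one_left (sq_nonneg _) (by nlinarith [norm_nonneg u])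
    rw [Complex.sq_norm, Complex.sq_norm X, Complex.normSq_apply, Complex.normSq_apply] at hle
    simp only [Complex.sub_re, Complex.sub_im, Complex.one_re, Complex.one_im] at hle
    nlinarith
  obtain ⟨w, ⟨h1, h2⟩, rfl⟩ := hz
  obtain ⟨X, hX0, hX, hXd⟩ := disc w.1 h1
  obtain ⟨Y, hY0, hY, hYd⟩ := disc w.2 h2
  have hα2 : 0 < 1 - ‖α‖ ^ 2 := by nlinarith [norm_nonneg α]
  have hmid : ‖X + Y - 2‖ ^ 2 ≤ (‖α‖ * ‖X + Y‖) ^ 2 := by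
    rw [mul_pow, Complex.sq_norm (X + Y - 2), Complex.sq_norm (X + Y), Complex.normSq_apply,
      Complex.normSq_apply]
    have e1 : (X + Y - 2).re = X.re + Y.re - 2 := by simp
    have e2 : (X + Y - 2).im = X.im + Y.im := by simp
    rw [e1, e2, Complex.add_re, Complex.add_im]
    nlinarith [mul_nonneg hα2.le (sq_nonneg (X.re - Y.re)),
      mul_nonneg hα2.le (sq_nonneg (X.im - Y.im))]
  have hmid' := (sq_le_sq₀ (norm_nonneg _) (by positivity)).1 hmid
  have e1 : α * (X * Y * (2 * α * (w.1 * w.2) - (w.1 + w.2))) = -(X + Y - 2) := by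
    linear_combination (2 * (1 - α * w.2) * Y - Y) * hX + (2 - X) * hY
  have e2 : X * Y * (2 - α * (w.1 + w.2)) = X + Y := by
    linear_combination Y * hX + X * hY
  have hfin : ‖α‖ * (‖X * Y‖ * ‖2 * α * (w.1 * w.2) - (w.1 + w.2)‖) ≤
      ‖α‖ * (‖X * Y‖ * ‖2 - α * (w.1 + w.2)‖) := by
    rw [← norm_mul, ← norm_mul, e1, ← norm_mul, e2, norm_neg]
    exact hmid'
  have hpos : 0 < ‖X * Y‖ := norm_pos_iff.2 (mul_ne_zero hX0 hY0)
  exact le_of_mul_le_mul_left (le_of_mul_le_mul_left hfin (norm_pos_iff.2 hα0)) hpos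

/-! ### Spectra -/

theorem mem_spectrum_iff_not_isUnit_sub {A : Type*} [Ring A] [Algebra ℂ A] {a : A} {s : ℂ} :
    s ∈ spectrum ℂ a ↔ ¬ IsUnit (a - s • 1) := by
  rw [spectrum.mem_iff, Algebra.algebraMap_eq_smul_one, IsUnit.sub_iff]

theorem spectralRadius_lt_one_iff {A : Type*} [NormedRing A] [NormedAlgebra ℂ A] [CompleteSpace A]
    {a : A} : spectralRadius ℂ a < 1 ↔ ∀ l ∈ spectrum ℂ a, ‖l‖ < 1 := by
  refine ⟨fun h l hl => ?_, fun h => ?_⟩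
  · have : (‖l‖₊ : ENNReal) < 1 := (le_iSup₂ (f := fun k (_ : k ∈ spectrum ℂ a) =>
      (‖k‖₊ : ENNReal)) l hl).trans_lt h
    exact_mod_cast this
  · rcases subsingleton_or_nontrivial A with hA | hA
    · simp [spectralRadius, spectrum.of_subsingleton]
    · exact_mod_cast spectrum.spectralRadius_lt_of_forall_lt a (r := 1) fun l hl => by
        exact_mod_cast h l hl

section Calc

variable {H : Type*} [NormedAddCommGroup H] [InnerProductSpace ℂ H]

/-! ### The polynomial calculus of a commuting pair -/

/-- The algebra homomorphism `f ↦ f(S, P)` of a commuting pair. -/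
def polyCalcHom {S P : H →L[ℂ] H} (h : Commute S P) :
    MvPolynomial (Fin 2) ℂ →ₐ[ℂ] (H →L[ℂ] H) :=
  AddMonoidAlgebra.lift ℂ (H →L[ℂ] H) (Fin 2 →₀ ℕ)
    { toFun := fun m => S ^ m.toAdd 0 * P ^ m.toAdd 1
      map_one' := by simp
      map_mul' := fun m n => by
        have := (h.pow_pow (n.toAdd 0) (m.toAdd 1)).eq
        simp only [toAdd_mul, Finsupp.add_apply, pow_add, mul_assoc]
        rw [← mul_assoc (P ^ _) (S ^ _), ← this]
        simp only [mul_assoc] }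

theorem polyCalcHom_apply {S P : H →L[ℂ] H} (h : Commute S P) (f : MvPolynomial (Fin 2) ℂ) :
    polyCalcHom h f = polyCalc S P f :=
  AddMonoidAlgebra.lift_apply _ _

@[simp] theorem polyCalcHom_X_zero {S P : H →L[ℂ] H} (h : Commute S P) :
    polyCalcHom h (MvPolynomial.X 0) = S := by
  refine (AddMonoidAlgebra.lift_single _ _ _).trans ?_
  simp

@[simp] theorem polyCalcHom_X_one {S P : H →L[ℂ] H} (h : Commute S P) :
    polyCalcHom h (MvPolynomial.X 1) = P := by
  refine (AddMonoidAlgebra.lift_single _ _ _).trans ?_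
  simp

@[simp] theorem polyCalcHom_C {S P : H →L[ℂ] H} (h : Commute S P) (c : ℂ) :
    polyCalcHom h (MvPolynomial.C c) = c • (1 : H →L[ℂ] H) := by
  rw [← MvPolynomial.algebraMap_eq, AlgHom.commutes, Algebra.algebraMap_eq_smul_one]

theorem adjoint_polyCalc [CompleteSpace H] {S P : H →L[ℂ] H} (h : Commute S P)
    (f : MvPolynomial (Fin 2) ℂ) :
    star (polyCalc S P f) = polyCalc (star S) (star P) (MvPolynomial.map (starRingEnd ℂ) f) := by
  have h' : Commute (star S) (star P) := h.star_star
  rw [← polyCalcHom_apply h, ← polyCalcHom_apply h']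
  induction f using MvPolynomial.induction_on with
  | C a => rw [MvPolynomial.map_C, polyCalcHom_C, polyCalcHom_C, star_smul, star_one]; rfl
  | add p q hp hq => simp [hp, hq]
  | mul_X p i hp =>
    have hc : Commute (polyCalcHom h' (MvPolynomial.map (starRingEnd ℂ) p))
        (polyCalcHom h' (MvPolynomial.X i)) := by
      rw [commute_iff_eq, ← map_mul, ← map_mul, mul_comm]
    have hX : star (polyCalcHom h (MvPolynomial.X i)) = polyCalcHom h' (MvPolynomial.X i) := by
      fin_cases i <;> simp
    rw [map_mul, star_mul, hp, hX, map_mul, MvPolynomial.map_X, map_mul, hc.eq]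

theorem polyVal_map_conj (f : MvPolynomial (Fin 2) ℂ) (z : ℂ × ℂ) :
    polyVal (MvPolynomial.map (starRingEnd ℂ) f) z = conj (polyVal f (conj z.1, conj z.2)) := by
  unfold polyVal
  induction f using MvPolynomial.induction_on with
  | C a => simp
  | add p q hp hq => simp_all
  | mul_X p i hp => fin_cases i <;> simp_all

/-- The restriction of `f` to the line `z₂ = c`. -/
def sectionPoly (f : MvPolynomial (Fin 2) ℂ) (c : ℂ) : Polynomial ℂ :=
  MvPolynomial.aeval ![Polynomial.X, Polynomial.C c] f

theorem eval_sectionPoly (f : MvPolynomial (Fin 2) ℂ) (c s : ℂ) :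
    (sectionPoly f c).eval s = polyVal f (s, c) := by
  unfold sectionPoly polyVal
  induction f using MvPolynomial.induction_on with
  | C a => simp
  | add p q hp hq => simp_all
  | mul_X p i hp => fin_cases i <;> simp_all

theorem polyCalc_smul_one (T : H →L[ℂ] H) (c : ℂ) (f : MvPolynomial (Fin 2) ℂ) :
    polyCalc T (c • 1) f = Polynomial.aeval T (sectionPoly f c) := by
  have h : Commute T (c • (1 : H →L[ℂ] H)) := (Commute.one_right T).smul_right c
  rw [← polyCalcHom_apply h]
  unfold sectionPoly
  induction f using MvPolynomial.induction_on with
  | C a => simp [Algebra.algebraMap_eq_smul_one]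
  | add p q hp hq => simp_all
  | mul_X p i hp => fin_cases i <;> simp_all [Algebra.algebraMap_eq_smul_one]

theorem koszulExact_of_isUnit_left {A B : H →L[ℂ] H} (hc : Commute A B) (hA : IsUnit A) :
    KoszulExact A B := by
  obtain ⟨u, rfl⟩ := hA
  have h1 (x : H) : (↑u⁻¹ : H →L[ℂ] H) ((u : H →L[ℂ] H) x) = x := by
    change ((↑u⁻¹ : H →L[ℂ] H) * (u : H →L[ℂ] H)) x = x
    rw [u.inv_mul]; rfl
  have h2 (x : H) : (u : H →L[ℂ] H) ((↑u⁻¹ : H →L[ℂ] H) x) = x := by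
    change ((u : H →L[ℂ] H) * (↑u⁻¹ : H →L[ℂ] H)) x = x
    rw [u.mul_inv]; rfl
  have h3 (x : H) : B ((↑u⁻¹ : H →L[ℂ] H) x) = (↑u⁻¹ : H →L[ℂ] H) (B x) := by
    exact (DFunLike.congr_fun hc.units_inv_left.eq x).symm
  refine ⟨fun x hx _ => by rw [← h1 x, hx, map_zero], fun x y hxy => ?_, fun w => ?_⟩
  · refine ⟨(↑u⁻¹ : H →L[ℂ] H) x, h2 x, ?_⟩
    rw [h3, ← sub_eq_zero.1 hxy, h1]
  · exact ⟨0, (↑u⁻¹ : H →L[ℂ] H) w, by simp [h2]⟩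

theorem KoszulExact.swap {A B : H →L[ℂ] H} (h : KoszulExact A B) : KoszulExact B A := by
  refine ⟨fun x hx hy => h.1 x hy hx, fun x y hxy => ?_, fun w => ?_⟩
  · obtain ⟨z, hz1, hz2⟩ := h.2.1 y x (by rw [← neg_sub, hxy, neg_zero])
    exact ⟨z, hz2, hz1⟩
  · obtain ⟨x, y, hxy⟩ := h.2.2 w
    exact ⟨-y, -x, by rw [← hxy]; simp; abel⟩

theorem spectrum_of_mem_taylorSpectrum_zero {F : H →L[ℂ] H} {l : ℂ × ℂ}
    (hl : l ∈ taylorSpectrum F 0) :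
    l.1 ∈ spectrum ℂ F ∧ l.2 = 0 := by
  have hc : Commute (F - l.1 • (1 : H →L[ℂ] H)) (0 - l.2 • (1 : H →L[ℂ] H)) := by
    rw [zero_sub]
    exact ((Commute.one_right _).smul_right _).neg_right
  constructor
  · rw [mem_spectrum_iff_not_isUnit_sub]
    exact fun hu => hl (koszulExact_of_isUnit_left hc hu)
  · by_contra h0
    refine hl (koszulExact_of_isUnit_left hc.symm ?_).swap
    rw [zero_sub]
    refine IsUnit.neg ?_
    rw [← Algebra.algebraMap_eq_smul_one]
    exact (isUnit_iff_ne_zero.2 h0).map _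

end Calc

section Pencil

variable {E : Type*} [NormedAddCommGroup E] [InnerProductSpace ℂ E] [FiniteDimensional ℂ E]

/-! ### Determinants of linear pencils -/

/-- The matrix of `A + z₂ B - z₁` over `ℂ[z₁, z₂]`, in some basis of `E`. -/
def pencilMatrix (A B : E →L[ℂ] E) :
    Matrix (Fin (Module.finrank ℂ E)) (Fin (Module.finrank ℂ E)) (MvPolynomial (Fin 2) ℂ) :=
  (LinearMap.toMatrix (Module.finBasis ℂ E) (Module.finBasis ℂ E) (A : E →ₗ[ℂ] E)).map
      MvPolynomial.C +
    (MvPolynomial.X 1 : MvPolynomial (Fin 2) ℂ) •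
      (LinearMap.toMatrix (Module.finBasis ℂ E) (Module.finBasis ℂ E) (B : E →ₗ[ℂ] E)).map
        MvPolynomial.C -
    (MvPolynomial.X 0 : MvPolynomial (Fin 2) ℂ) • 1

/-- The polynomial `det (A + z₂ B - z₁)`. -/
def pencilPoly (A B : E →L[ℂ] E) : MvPolynomial (Fin 2) ℂ := (pencilMatrix A B).det

theorem polyVal_pencilPoly_eq_zero_iff (A B : E →L[ℂ] E) (z : ℂ × ℂ) :
    polyVal (pencilPoly A B) z = 0 ↔ ¬ IsUnit (A + z.2 • B - z.1 • 1) := by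
  have hdet : polyVal (pencilPoly A B) z =
      LinearMap.det (((A + z.2 • B - z.1 • 1 : E →L[ℂ] E)) : E →ₗ[ℂ] E) := by
    rw [← LinearMap.det_toMatrix (Module.finBasis ℂ E)]
    unfold polyVal pencilPoly
    rw [RingHom.map_det]
    congr 1
    ext i j
    by_cases hij : i = j <;>
    simp [pencilMatrix, LinearMap.toMatrix_apply, hij]
  have : CompleteSpace E := FiniteDimensional.complete ℂ E
  rw [hdet, isUnit_iff_isUnit_toLinearMap, LinearMap.isUnit_iff_isUnit_det, isUnit_iff_ne_zero,
    not_not]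

/-- If `L S = A L + B L P`, the row vector of coordinates of `L` is annihilated by the matrix
`A + z₂ B - z₁`, the variables acting by composition with `S` and `P`. Multiplying by the adjugate,
`L` is annihilated by the determinant. For `L = id`, `P = 0` this is the Cayley–Hamilton
theorem. -/
theorem comp_polyCalc_pencilPoly {H : Type*} [NormedAddCommGroup H] [InnerProductSpace ℂ H]
    {S P : H →L[ℂ] H} (hc : Commute S P) {A B : E →L[ℂ] E} {L : H →L[ℂ] E}
    (h : ∀ x, L (S x) = A (L x) + B (L (P x))) (x : H) :
    L (polyCalc S P (pencilPoly A B) x) = 0 := by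
  set b := Module.finBasis ℂ E with hb
  set M := pencilMatrix A B with hM
  have hcoord (T : E →L[ℂ] E) (v : E) (i) :
      ∑ j, LinearMap.toMatrix b b (T : E →ₗ[ℂ] E) i j * b.repr v j = b.repr (T v) i := by
    have := congrFun (LinearMap.toMatrix_mulVec_repr b b (T : E →ₗ[ℂ] E) v) i
    simpa [Matrix.mulVec, dotProduct] using this
  have hrow (i) (y : H) : ∑ j, b.repr (L (polyCalcHom hc (M i j) y)) j = 0 := by
    have hterm (j) : b.repr (L (polyCalcHom hc (M i j) y)) j =
        LinearMap.toMatrix b b (A : E →ₗ[ℂ] E) i j * b.repr (L y) j +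
          LinearMap.toMatrix b b (B : E →ₗ[ℂ] E) i j * b.repr (L (P y)) j -
          (if i = j then b.repr (L (S y)) j else 0) := by
      by_cases hij : i = j <;>
      simp [hM, pencilMatrix, hij, ← hb]
    simp_rw [hterm]
    rw [Finset.sum_sub_distrib, Finset.sum_add_distrib, hcoord, hcoord, h]
    simp
  rw [← polyCalcHom_apply hc, ← b.repr.map_eq_zero_iff]
  ext i
  have hexp (j) : ∑ k, b.repr (L (polyCalcHom hc (M k j) (polyCalcHom hc (M.adjugate i k) x))) j =
      b.repr (L (polyCalcHom hc ((M.adjugate * M) i j) x)) j := by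
    rw [Matrix.mul_apply, map_sum]
    simp only [mul_comm (M.adjugate i _), map_mul, sum_apply, map_sum,
      Finsupp.finsetSum_apply]
    rfl
  have hsum : ∑ j, b.repr (L (polyCalcHom hc ((M.adjugate * M) i j) x)) j = 0 := by
    simp_rw [← hexp]
    rw [Finset.sum_comm]
    exact Finset.sum_eq_zero fun k _ => hrow k _
  rw [Matrix.adjugate_mul, Finset.sum_eq_single i] at hsum
  · simpa [pencilPoly] using hsum
  · intro j _ hj
    simp [hj.symm]
  · simp

end Pencil

section NumericalRange

variable {E : Type*} [NormedAddCommGroup E] [InnerProductSpace ℂ E] [CompleteSpace E]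

/-! ### Operators of numerical radius at most one -/

theorem norm_inner_star_le {F : E →L[ℂ] E} (hF : ∀ v, ‖inner ℂ v (F v)‖ ≤ ‖v‖ ^ 2) (v : E) :
    ‖inner ℂ v (star F v)‖ ≤ ‖v‖ ^ 2 := by
  rw [star_eq_adjoint, adjoint_inner_right, norm_inner_symm]
  exact hF v

theorem _root_.ContinuousLinearMap.IsPositive.apply_eq_zero_of_inner_eq_zero {K : E →L[ℂ] E}
    (hK : K.IsPositive) {v : E} (hv : inner ℂ (K v) v = 0) : K v = 0 := by
  have hK0 : 0 ≤ K := (nonneg_iff_isPositive K).2 hK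
  have hsa : adjoint (CFC.sqrt K) = CFC.sqrt K :=
    ((nonneg_iff_isPositive _).1 (CFC.sqrt_nonneg K)).isSelfAdjoint
  have hmul (x : E) : CFC.sqrt K (CFC.sqrt K x) = K x :=
    DFunLike.congr_fun (CFC.sqrt_mul_sqrt_self K hK0) x
  have h0 : CFC.sqrt K v = 0 := by
    rw [← inner_self_eq_zero (𝕜 := ℂ), ← adjoint_inner_left, hsa, hmul, hv]
  rw [← hmul, h0, map_zero]

/-- A unit vector at which the quadratic form of `F` attains a modulus equal to the bound
annihilates the positive operator `2 - conj a • F - a • F*`. -/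
theorem conj_smul_add_smul_star_apply {F : E →L[ℂ] E}
    (hF : ∀ v, ‖inner ℂ v (F v)‖ ≤ ‖v‖ ^ 2) {v : E} (hv : ‖v‖ = 1) {a : ℂ}
    (ha : inner ℂ v (F v) = a) (ha1 : ‖a‖ = 1) :
    conj a • F v + a • star F v = (2 : ℂ) • v := by
  set K : E →L[ℂ] E := (2 : ℂ) • 1 - conj a • F - a • star F with hKdef
  have hinner (x : E) : inner ℂ (K x) x =
      2 * ((‖x‖ ^ 2 : ℝ) : ℂ) - a * conj (inner ℂ x (F x)) - conj a * inner ℂ x (F x) := by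
    have h2 : conj (2 : ℂ) = 2 := Complex.conj_ofNat 2
    simp only [hKdef, sub_apply, smul_apply, one_apply_eq_self, inner_sub_left, inner_smul_left,
      star_eq_adjoint, adjoint_inner_left, inner_conj_symm, Complex.conj_conj, h2,
      inner_self_eq_norm_sq_to_K]
    push_cast
    rfl
  have hpos : K.IsPositive := by
    refine isPositive_def.2 ⟨?_, fun x => ?_⟩
    · rw [← isSelfAdjoint_iff_isSymmetric, isSelfAdjoint_iff, hKdef]
      simp only [star_sub, star_smul, star_one, star_star]
      simp only [RCLike.star_def, Complex.conj_conj, Complex.conj_ofNat]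
      abel
    · rw [reApplyInnerSelf_apply, hinner]
      have h1 : ‖conj a * inner ℂ x (F x)‖ ≤ ‖x‖ ^ 2 := by
        rw [norm_mul, Complex.norm_conj, ha1, one_mul]; exact hF x
      have h2 := (Complex.re_le_norm _).trans h1
      have h3 : (a * conj (inner ℂ x (F x))).re = (conj a * inner ℂ x (F x)).re := by
        rw [← Complex.conj_re, map_mul, Complex.conj_conj]
      have h4 : ((2 : ℂ) * ((‖x‖ ^ 2 : ℝ) : ℂ)).re = 2 * ‖x‖ ^ 2 := by
        rw [Complex.re_mul_ofReal]; simp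
      simp only [RCLike.re_to_complex, Complex.sub_re, h3, h4]
      linarith
  have hzero : inner ℂ (K v) v = 0 := by
    have h5 : a * conj a = 1 := by
      rw [Complex.mul_conj, Complex.normSq_eq_norm_sq, ha1]; simp
    rw [hinner, ha, hv]
    push_cast
    linear_combination -2 * h5
  have := hpos.apply_eq_zero_of_inner_eq_zero hzero
  simp only [hKdef, sub_apply, smul_apply, one_apply_eq_self] at this
  rw [sub_sub, sub_eq_zero] at this
  exact this.symm

theorem isUnit_polyCalc [Nontrivial E] {T : E →L[ℂ] E} {z : ℂ} {q : MvPolynomial (Fin 2) ℂ}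
    (h : ∀ s ∈ spectrum ℂ T, polyVal q (s, z) ≠ 0) : IsUnit (polyCalc T (z • 1) q) := by
  by_contra hu
  rw [polyCalc_smul_one, ← spectrum.zero_mem_iff ℂ, spectrum.map_polynomial_aeval] at hu
  obtain ⟨s, hs, h0⟩ := hu
  exact h s hs (by rwa [← eval_sectionPoly])

/-- If `T* = c T`, then `p(T, z) / q(T, z)` is normal, so its norm is its spectral radius, and its
spectrum consists of the values `p(s, z) / q(s, z)` for `s` in the spectrum of `T`. -/
theorem norm_polyCalc_mul_inverse_le [Nontrivial E] {T : E →L[ℂ] E} {c z : ℂ}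
    (hT : star T = c • T) {p q : MvPolynomial (Fin 2) ℂ} {C : ℝ} (hC : 0 ≤ C)
    (hq : ∀ s ∈ spectrum ℂ T, polyVal q (s, z) ≠ 0)
    (hpq : ∀ s ∈ spectrum ℂ T, ‖polyVal p (s, z) / polyVal q (s, z)‖ ≤ C) :
    ‖polyCalc T (z • 1) p * Ring.inverse (polyCalc T (z • 1) q)‖ ≤ C := by
  have hc : Commute T (z • (1 : E →L[ℂ] E)) := (Commute.one_right T).smul_right z
  obtain ⟨u, hu⟩ := isUnit_polyCalc hq
  set X := polyCalc T (z • 1) p * Ring.inverse (polyCalc T (z • 1) q) with hX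
  rw [← hu, Ring.inverse_unit] at hX
  have hcomm {R : E →L[ℂ] E} (hR : Commute R T) : Commute R X := by
    have hpoly (f) : Commute R (polyCalc T (z • 1) f) := by
      rw [polyCalc_smul_one]
      induction sectionPoly f z using Polynomial.induction_on' with
      | add a b ha hb => rw [map_add]; exact ha.add_right hb
      | monomial n a =>
        rw [Polynomial.aeval_monomial]
        exact (Algebra.commute_algebraMap_right a R).mul_right (hR.pow_right n)
    rw [hX]
    exact (hpoly p).mul_right (Commute.units_inv_right (hu ▸ hpoly q))
  have hXT : Commute X T := (hcomm (Commute.refl T)).symm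
  have hXsT : Commute (star X) T := by
    have : Commute X (star T) := by rw [hT]; exact hXT.smul_right c
    simpa using this.star_star
  have : IsStarNormal X := ⟨hcomm hXsT⟩
  have hspec : ∀ m ∈ spectrum ℂ X, ‖m‖ ≤ C := by
    intro m hm
    by_contra! hlt
    refine hm ?_
    have hne : ∀ s ∈ spectrum ℂ T, polyVal (MvPolynomial.C m * q - p) (s, z) ≠ 0 := by
      intro s hs h0
      have h1 : m * polyVal q (s, z) - polyVal p (s, z) = 0 := by
        simpa [polyVal] using h0
      have h2 := hpq s hs
      rw [← sub_eq_zero.1 h1, mul_div_cancel_right₀ _ (hq s hs)] at h2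
      exact absurd h2 (not_le.2 hlt)
    have hunit := isUnit_polyCalc hne
    rw [← polyCalcHom_apply hc, map_sub, map_mul, polyCalcHom_C, polyCalcHom_apply,
      polyCalcHom_apply, ← hu] at hunit
    have : algebraMap ℂ (E →L[ℂ] E) m - X =
        (m • (1 : E →L[ℂ] E) * ↑u - polyCalc T (z • 1) p) * ↑u⁻¹ := by
      rw [hX, sub_mul, mul_assoc, u.mul_inv, mul_one, Algebra.algebraMap_eq_smul_one]
    change IsUnit (algebraMap ℂ (E →L[ℂ] E) m - X)
    rw [this]
    exact hunit.mul u⁻¹.isUnit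
  have hrad : spectralRadius ℂ X ≤ ENNReal.ofReal C := by
    refine iSup₂_le fun m hm => ?_
    rw [← enorm_eq_nnnorm, ← ofReal_norm]
    exact ENNReal.ofReal_le_ofReal (hspec m hm)
  rw [IsStarNormal.spectralRadius_eq_nnnorm X, ← enorm_eq_nnnorm, ← ofReal_norm,
    ENNReal.ofReal_le_ofReal_iff hC] at hrad
  exact hrad

theorem differentiable_polyCalc_pencil (A B : E →L[ℂ] E) (f : MvPolynomial (Fin 2) ℂ) :
    Differentiable ℂ fun z : ℂ => polyCalc (A + z • B) (z • 1) f := by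
  unfold polyCalc
  fun_prop

variable [FiniteDimensional ℂ E]

theorem exists_unit_eigenvector {T : E →L[ℂ] E} {s : ℂ} (h : ¬ IsUnit (T - s • 1)) :
    ∃ v, ‖v‖ = 1 ∧ T v = s • v := by
  rw [isUnit_iff_isUnit_toLinearMap, LinearMap.isUnit_iff_ker_eq_bot,
    Submodule.eq_bot_iff] at h
  push Not at h
  obtain ⟨v, hv, hv0⟩ := h
  have hv' : T v = s • v := by
    have : T v - s • v = 0 := by simpa using hv
    exact sub_eq_zero.1 this
  refine ⟨((‖v‖⁻¹ : ℝ) : ℂ) • v, ?_, ?_⟩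
  · rw [norm_smul, Complex.norm_real, norm_inv, norm_norm,
      inv_mul_cancel₀ (norm_ne_zero_iff.2 hv0)]
  · rw [map_smul, hv', smul_comm]

theorem not_isUnit_sub_of_apply_eq {T : E →L[ℂ] E} {s : ℂ} {v : E} (hv : v ≠ 0)
    (h : T v = s • v) : ¬ IsUnit (T - s • 1) := by
  rw [isUnit_iff_isUnit_toLinearMap, LinearMap.isUnit_iff_ker_eq_bot, Submodule.eq_bot_iff]
  exact fun h' => hv (h' v (by simp [h]))

/-- An eigenvalue `s` of `F + z F*` has the form `a + z * conj a` with `a = ⟪v, F v⟫`. -/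
theorem exists_eq_add_conj_mul {F : E →L[ℂ] E} (hF : ∀ v, ‖inner ℂ v (F v)‖ ≤ ‖v‖ ^ 2)
    {s z : ℂ} (h : ¬ IsUnit (F + z • star F - s • 1)) :
    ∃ v a, ‖v‖ = 1 ∧ F v + z • star F v = s • v ∧ inner ℂ v (F v) = a ∧ ‖a‖ ≤ 1 ∧
      s = a + conj a * z := by
  obtain ⟨v, hv, hs⟩ := exists_unit_eigenvector h
  refine ⟨v, _, hv, hs, rfl, by simpa [hv] using hF v, ?_⟩
  have h1 := congrArg (inner ℂ v) hs
  simp only [add_apply, smul_apply, inner_add_right, inner_smul_right, star_eq_adjoint,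
    adjoint_inner_right] at h1
  rw [inner_self_eq_norm_sq_to_K, hv, ← inner_conj_symm (F v) v] at h1
  simp only [RCLike.ofReal_one, one_pow, mul_one] at h1
  rw [← h1, mul_comm z]

theorem mem_Gam_of_mem_spectrum {F : E →L[ℂ] E} (hF : ∀ v, ‖inner ℂ v (F v)‖ ≤ ‖v‖ ^ 2)
    {s z : ℂ} (hz : ‖z‖ ≤ 1) (h : s ∈ spectrum ℂ (F + z • star F)) : (s, z) ∈ Gam := by
  obtain ⟨v, a, -, -, -, ha, rfl⟩ := exists_eq_add_conj_mul hF (mem_spectrum_iff_not_isUnit_sub.1 h)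
  exact mem_Gam_of_norm_le ha hz

/-- A zero in `∂Γ` with `‖z₂‖ < 1` forces `‖a‖ = 1` in `s = a + z₂ * conj a`; comparing the
eigenvalue equation with `conj_smul_add_smul_star_apply` then gives `F v = a • v`, so that `F` has
a unimodular eigenvalue. The factor `z₁` provides the zero `(0, 0)` in `𝔾₂` even when `g` is
constant, as happens for `E = 0`. -/
theorem isGammaDistinguishedPoly_X_mul {F : E →L[ℂ] E}
    (hF : ∀ v, ‖inner ℂ v (F v)‖ ≤ ‖v‖ ^ 2) (hr : ∀ l ∈ spectrum ℂ F, ‖l‖ < 1)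
    {g : MvPolynomial (Fin 2) ℂ}
    (hg : ∀ z, polyVal g z = 0 → ¬ IsUnit (F + z.2 • star F - z.1 • 1)) :
    IsGammaDistinguishedPoly (MvPolynomial.X 0 * g) := by
  refine isGammaDistinguishedPoly_of ⟨(0, 0), by simp [zeroSet, polyVal],
    (0, 0), by simp, by simp [symmetrization]⟩ ?_
  rintro ⟨s, p⟩ hz hfr
  have hp := norm_snd_le_of_mem_Gam (isCompact_Gam.isClosed.frontier_subset hfr)
  by_contra hne
  have hp1 : ‖p‖ < 1 := lt_of_le_of_ne hp hne
  have hz' : s = 0 ∨ polyVal g (s, p) = 0 := by simpa [zeroSet, polyVal] using hz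
  rcases hz' with rfl | hz'
  · exact hfr.2 (by simpa using mem_interior_Gam (β := 0) (by simp) hp1)
  · obtain ⟨v, a, hv, hsv, ha, ha1, hs⟩ := exists_eq_add_conj_mul hF (hg _ hz')
    dsimp only at hsv hs
    subst hs
    rcases ha1.lt_or_eq with hlt | heq
    · exact hfr.2 (mem_interior_Gam hlt hp1)
    · have hK := conj_smul_add_smul_star_apply hF hv ha heq
      have haa : a * conj a = 1 := by
        rw [Complex.mul_conj, Complex.normSq_eq_norm_sq, heq]; simp
      have hcoef : 1 - p * (conj a * conj a) ≠ 0 := by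
        intro h0
        have h1 : ‖p * (conj a * conj a)‖ = 1 := by rw [← sub_eq_zero.1 h0, norm_one]
        rw [norm_mul, norm_mul, Complex.norm_conj, heq] at h1
        simp only [mul_one] at h1
        exact hp1.ne h1
      have hstar : star F v = conj a • ((2 : ℂ) • v - conj a • F v) := by
        rw [← hK, add_sub_cancel_left, smul_smul, mul_comm, haa, one_smul]
      have hFv : F v = a • v := by
        rw [← sub_eq_zero]
        refine (smul_eq_zero.1 ?_).resolve_left hcoef
        rw [hstar] at hsv
        rw [← sub_eq_zero] at hsv
        rw [← hsv, ← sub_eq_zero]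
        match_scalars
        · ring
        · linear_combination (p * conj a) * haa
      have hv0 : v ≠ 0 := by
        rintro rfl
        simp at hv
      exact (hr a (mem_spectrum_iff_not_isUnit_sub.2 (not_isUnit_sub_of_apply_eq hv0 hFv))).ne heq

/-- The pairs `(F + z F*, z)`, `‖z‖ ≤ 1`, form an analytic disc through `(F, 0)` with joint spectra
in `Γ`. On the circle `F + z F*` is normal, so the von Neumann inequality is clear there, and the
maximum modulus principle carries it to the centre. -/
theorem isGammaContraction_zero {F : E →L[ℂ] E} (hF : ∀ v, ‖inner ℂ v (F v)‖ ≤ ‖v‖ ^ 2) :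
    IsGammaContraction F 0 := by
  refine ⟨Commute.zero_right F, fun l hl => ?_, fun p q hq => ?_⟩
  · obtain ⟨h1, h2⟩ := spectrum_of_mem_taylorSpectrum_zero hl
    have := mem_Gam_of_mem_spectrum hF (s := l.1) (z := 0) (by simp) (by simpa using h1)
    rwa [← h2] at this
  set C := sSup ((fun z => ‖polyVal p z / polyVal q z‖) '' Gam) with hCdef
  have hC : 0 ≤ C := Real.sSup_nonneg (by rintro _ ⟨z, -, rfl⟩; exact norm_nonneg _)
  rcases subsingleton_or_nontrivial E with hE | hE
  · rw [Subsingleton.elim (polyCalc F 0 p * _) 0, norm_zero]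
    exact hC
  have hunit {z : ℂ} (hz : ‖z‖ ≤ 1) : IsUnit (polyCalc (F + z • star F) (z • 1) q) :=
    isUnit_polyCalc fun s hs => hq _ (mem_Gam_of_mem_spectrum hF hz hs)
  set G : ℂ → (E →L[ℂ] E) := fun z => polyCalc (F + z • star F) (z • 1) p *
    Ring.inverse (polyCalc (F + z • star F) (z • 1) q) with hG
  have hdiff : DiffContOnCl ℂ G (Metric.ball 0 1) := by
    refine DifferentiableOn.diffContOnCl fun z hz => ?_
    rw [closure_ball _ one_ne_zero, mem_closedBall_zero_iff] at hz
    refine DifferentiableAt.differentiableWithinAt ?_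
    have hinv : DifferentiableAt ℂ
        (fun w => Ring.inverse (polyCalc (F + w • star F) (w • 1) q)) z :=
      DifferentiableAt.comp (𝕜 := ℂ) (g := Ring.inverse) z (differentiableAt_inverse (hunit hz))
        (differentiable_polyCalc_pencil F (star F) q z)
    exact (differentiable_polyCalc_pencil F (star F) p z).mul hinv
  have hbdry : ∀ z ∈ frontier (Metric.ball (0 : ℂ) 1), ‖G z‖ ≤ C := by
    intro z hz
    rw [frontier_ball _ one_ne_zero, mem_sphere_zero_iff_norm] at hz
    have hzz : conj z * z = 1 := by
      rw [mul_comm, Complex.mul_conj, Complex.normSq_eq_norm_sq, hz]; simp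
    refine norm_polyCalc_mul_inverse_le (c := conj z) ?_ hC
      (fun s hs => hq _ (mem_Gam_of_mem_spectrum hF hz.le hs))
      (fun s hs => le_csSup (bddAbove_rational_image hq)
        ⟨_, mem_Gam_of_mem_spectrum hF hz.le hs, rfl⟩)
    rw [star_add, star_smul, star_star, smul_add, smul_smul, hzz, one_smul, add_comm]
    rfl
  have := Complex.norm_le_of_forall_mem_frontier_norm_le Metric.isBounded_ball hdiff hbdry
    (subset_closure (Metric.mem_ball_self one_pos))
  simpa [hG] using this

/-- An annihilating polynomial `f` vanishes at `(l, 0)` for `l` in the spectrum of `F`. When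
`‖l‖ = 1` this point lies in `∂Γ` but not in `bΓ`. -/
theorem norm_lt_one_of_isGammaDistinguished {F : E →L[ℂ] E} (h : IsGammaDistinguished F 0)
    (hF : ∀ v, ‖inner ℂ v (F v)‖ ≤ ‖v‖ ^ 2) {l : ℂ} (hl : l ∈ spectrum ℂ F) : ‖l‖ < 1 := by
  obtain ⟨-, f, ⟨-, hf⟩, hf0⟩ := h
  have hle : ‖l‖ ≤ 1 := mk_zero_mem_Gam_iff.1
    (mem_Gam_of_mem_spectrum hF (z := 0) (by simp) (by simpa using hl))
  refine lt_of_le_of_ne hle fun heq => ?_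
  obtain ⟨v, hv, hlv⟩ := exists_unit_eigenvector (mem_spectrum_iff_not_isUnit_sub.1 hl)
  have hE : Nontrivial E := ⟨v, 0, by rintro rfl; simp at hv⟩
  have hz : polyVal f (l, 0) = 0 := by
    have h1 := spectrum.subset_polynomial_aeval F (sectionPoly f 0) ⟨l, hl, rfl⟩
    rw [← polyCalc_smul_one, zero_smul, hf0, spectrum.zero_eq] at h1
    simpa [eval_sectionPoly] using h1
  have hmem : (l, (0 : ℂ)) ∈ zeroSet f ∩ distinguishedBoundary :=
    hf ▸ ⟨hz, mk_zero_mem_frontier heq⟩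
  simpa using norm_snd_of_mem_distinguishedBoundary hmem.2

theorem isGammaDistinguished_zero_iff {F : E →L[ℂ] E} (hF : ∀ v, ‖inner ℂ v (F v)‖ ≤ ‖v‖ ^ 2) :
    IsGammaDistinguished F 0 ↔ spectralRadius ℂ F < 1 := by
  rw [spectralRadius_lt_one_iff]
  refine ⟨fun h l hl => norm_lt_one_of_isGammaDistinguished h hF hl, fun hr => ?_⟩
  refine ⟨isGammaContraction_zero hF, MvPolynomial.X 0 * pencilPoly F (star F),
    isGammaDistinguishedPoly_X_mul hF hr fun z => (polyVal_pencilPoly_eq_zero_iff _ _ z).1, ?_⟩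
  have h0 : polyCalc F 0 (pencilPoly F (star F)) = 0 := by
    ext x
    exact comp_polyCalc_pencilPoly (Commute.zero_right F)
      (L := ContinuousLinearMap.id ℂ E) (fun x => by simp) x
  rw [← polyCalcHom_apply (Commute.zero_right F), map_mul, polyCalcHom_apply,
    polyCalcHom_apply, h0, mul_zero]

end NumericalRange

section GammaContraction

variable {H : Type*} [NormedAddCommGroup H] [InnerProductSpace ℂ H]

/-! ### Defect operators and the fundamental operator -/

theorem IsGammaContraction.norm_rational_le {S P : H →L[ℂ] H} (h : IsGammaContraction S P)
    {p q : MvPolynomial (Fin 2) ℂ} (hq : ∀ z ∈ Gam, polyVal q z ≠ 0) {C : ℝ} (hC : 0 ≤ C)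
    (hpq : ∀ z ∈ Gam, ‖polyVal p z‖ ≤ C * ‖polyVal q z‖) :
    ‖polyCalc S P p * Ring.inverse (polyCalc S P q)‖ ≤ C := by
  refine (h.vonNeumann p q hq).trans (Real.sSup_le ?_ hC)
  rintro _ ⟨z, hz, rfl⟩
  change ‖polyVal p z / polyVal q z‖ ≤ C
  rw [norm_div, div_le_iff₀ (norm_pos_iff.2 (hq z hz))]
  exact hpq z hz

theorem IsGammaContraction.norm_polynomial_le {S P : H →L[ℂ] H} (h : IsGammaContraction S P)
    {p : MvPolynomial (Fin 2) ℂ} {C : ℝ} (hC : 0 ≤ C) (hp : ∀ z ∈ Gam, ‖polyVal p z‖ ≤ C) :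
    ‖polyCalc S P p‖ ≤ C := by
  have := h.norm_rational_le (p := p) (q := 1) (by simp [polyVal]) hC (by simpa [polyVal] using hp)
  rwa [← polyCalcHom_apply h.commute 1, map_one, Ring.inverse_one, mul_one] at this

theorem IsGammaContraction.norm_fst_le {S P : H →L[ℂ] H} (h : IsGammaContraction S P) :
    ‖S‖ ≤ 2 := by
  have := h.norm_polynomial_le (p := MvPolynomial.X 0) two_pos.le
    (fun z hz => by simpa [polyVal] using norm_fst_le_of_mem_Gam hz)
  rwa [← polyCalcHom_apply h.commute, polyCalcHom_X_zero] at this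

theorem IsGammaContraction.norm_snd_le {S P : H →L[ℂ] H} (h : IsGammaContraction S P) :
    ‖P‖ ≤ 1 := by
  have := h.norm_polynomial_le (p := MvPolynomial.X 1) one_pos.le
    (fun z hz => by simpa [polyVal] using norm_snd_le_of_mem_Gam hz)
  rwa [← polyCalcHom_apply h.commute, polyCalcHom_X_one] at this

variable [CompleteSpace H]

/-- The von Neumann inequality for `(2 α z₂ - z₁) / (2 - α z₁)`, which is bounded by `1` on `Γ`,
passed to adjoints. The bound `‖S‖ ≤ 2` makes `2 - α S` invertible. -/
theorem IsGammaContraction.norm_two_mul_sub_apply_le_of_lt {S P : H →L[ℂ] H}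
    (h : IsGammaContraction S P) {α : ℂ} (hα : ‖α‖ < 1) (hα0 : α ≠ 0) (x : H) :
    ‖(2 * α) • adjoint P x - adjoint S x‖ ≤ ‖(2 : ℂ) • x - α • adjoint S x‖ := by
  set a := conj α with ha
  have ha1 : ‖a‖ < 1 := by rwa [ha, Complex.norm_conj]
  have ha0 : a ≠ 0 := by simpa [ha] using hα0
  have hval (z : ℂ × ℂ) : polyVal (MvPolynomial.C 2 - MvPolynomial.C a * MvPolynomial.X 0) z =
      2 - a * z.1 := by simp [polyVal]
  have hval' (z : ℂ × ℂ) : polyVal (MvPolynomial.C (2 * a) * MvPolynomial.X 1 -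
      MvPolynomial.X 0) z = 2 * a * z.2 - z.1 := by simp [polyVal]
  have hq : ∀ z ∈ Gam,
      polyVal (MvPolynomial.C 2 - MvPolynomial.C a * MvPolynomial.X 0) z ≠ 0 := by
    intro z hz h0
    rw [hval, sub_eq_zero] at h0
    have h1 : ‖a * z.1‖ = 2 := by rw [← h0]; simp
    rw [norm_mul] at h1
    nlinarith [norm_fst_le_of_mem_Gam hz, norm_nonneg a, norm_nonneg z.1]
  have hle := h.norm_rational_le
    (p := MvPolynomial.C (2 * a) * MvPolynomial.X 1 - MvPolynomial.X 0) hq one_pos.le fun z hz => by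
    rw [hval, hval', one_mul]
    exact norm_two_mul_sub_le ha1 ha0 hz
  rw [← polyCalcHom_apply h.commute, ← polyCalcHom_apply h.commute] at hle
  simp only [map_sub, map_mul, polyCalcHom_C, polyCalcHom_X_one, polyCalcHom_X_zero,
    smul_mul_assoc, one_mul, smul_smul] at hle
  set Q : H →L[ℂ] H := (2 : ℂ) • 1 - a • S with hQ
  set T : H →L[ℂ] H := (2 * a) • P - S with hT
  have hTQ : Commute T Q := by
    refine Commute.sub_right ((Commute.one_right _).smul_right _) (Commute.smul_right ?_ _)
    exact (h.commute.symm.smul_left _).sub_left (Commute.refl S)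
  have hunit : IsUnit Q := by
    have h1 : ‖(a / 2) • S‖ < 1 := by
      rw [norm_smul, norm_div, Complex.norm_ofNat]
      nlinarith [h.norm_fst_le, norm_nonneg a, norm_nonneg S]
    have h2 : Q = (2 : ℂ) • (1 - (a / 2) • S) := by
      rw [hQ, smul_sub, smul_smul, mul_div_cancel₀ _ two_ne_zero]
    rw [h2]
    exact (isUnit_one_sub_of_norm_lt_one h1).smul (Units.mk0 (2 : ℂ) two_ne_zero)
  obtain ⟨u, hu⟩ := hunit
  rw [← hu, Ring.inverse_unit] at hle
  have hfac : T = Q * (T * (↑u⁻¹ : H →L[ℂ] H)) := by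
    rw [← mul_assoc, ← hTQ.eq, ← hu, mul_assoc, u.mul_inv, mul_one]
  have hadj : adjoint T x = adjoint (T * (↑u⁻¹ : H →L[ℂ] H)) (adjoint Q x) := by
    conv_lhs => rw [hfac]
    rw [← star_eq_adjoint, star_mul]
    rfl
  have hTx : adjoint T x = (2 * α) • adjoint P x - adjoint S x := by
    rw [hT, ← star_eq_adjoint, star_sub, star_smul, ha]
    simp [star_eq_adjoint]
  have hQx : adjoint Q x = (2 : ℂ) • x - α • adjoint S x := by
    rw [hQ, ← star_eq_adjoint, star_sub, star_smul, star_smul, ha]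
    simp [star_eq_adjoint]
  rw [← hTx, ← hQx, hadj]
  refine (le_opNorm _ _).trans (mul_le_of_le_one_left (norm_nonneg _) ?_)
  rwa [LinearIsometryEquiv.norm_map]

theorem IsGammaContraction.norm_two_mul_sub_apply_le {S P : H →L[ℂ] H}
    (h : IsGammaContraction S P) {α : ℂ} (hα : ‖α‖ = 1) (x : H) :
    ‖(2 * α) • adjoint P x - adjoint S x‖ ≤ ‖(2 : ℂ) • x - α • adjoint S x‖ := by
  have hα0 : α ≠ 0 := by
    rintro rfl
    simp at hα
  have h1 : Continuous fun t : ℝ => ‖(2 * (t * α)) • adjoint P x - adjoint S x‖ := by fun_prop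
  have h2 : Continuous fun t : ℝ => ‖(2 : ℂ) • x - ((t : ℂ) * α) • adjoint S x‖ := by fun_prop
  have := le_of_tendsto_of_tendsto ((h1.tendsto 1).mono_left nhdsWithin_le_nhds)
    ((h2.tendsto 1).mono_left nhdsWithin_le_nhds) (b := 𝓝[<] (1 : ℝ)) (by
      filter_upwards [Ioo_mem_nhdsLT (zero_lt_one (α := ℝ))] with t ht
      refine h.norm_two_mul_sub_apply_le_of_lt ?_ (mul_ne_zero ?_ hα0) x
      · rw [norm_mul, hα, mul_one, Complex.norm_real, Real.norm_of_nonneg ht.1.le]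
        exact ht.2
      · exact_mod_cast ht.1.ne')
  simpa using this

theorem IsGammaContraction.re_inner_le {S P : H →L[ℂ] H}
    (h : IsGammaContraction S P) {α : ℂ} (hα : ‖α‖ = 1) (x : H) :
    (α * inner ℂ x (adjoint S x - S (adjoint P x))).re ≤ ‖x‖ ^ 2 - ‖adjoint P x‖ ^ 2 := by
  have h1 := pow_le_pow_left₀ (norm_nonneg _) (h.norm_two_mul_sub_apply_le hα x) 2
  rw [norm_sub_sq (𝕜 := ℂ), norm_sub_sq (𝕜 := ℂ), norm_smul, norm_smul, norm_smul, norm_mul, hα]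
    at h1
  have e1 : inner ℂ ((2 : ℂ) • x) (α • adjoint S x) = 2 * (α * inner ℂ x (adjoint S x)) := by
    rw [inner_smul_left, inner_smul_right, Complex.conj_ofNat]
  have e2 : RCLike.re (inner ℂ ((2 * α) • adjoint P x) (adjoint S x)) =
      (2 * (α * inner ℂ x (S (adjoint P x)))).re := by
    rw [← inner_conj_symm, inner_smul_right, adjoint_inner_left, RCLike.conj_re, mul_assoc]
    rfl
  rw [e1, e2] at h1
  simp only [RCLike.re_to_complex, Complex.re_ofNat, Complex.im_ofNat, zero_mul, sub_zero,
    Complex.mul_re (2 : ℂ), Complex.norm_ofNat, mul_one, one_mul] at h1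
  rw [inner_sub_right, mul_sub, Complex.sub_re]
  nlinarith

theorem adjoint_defectOp (P : H →L[ℂ] H) : adjoint (defectOp P) = defectOp P := by
  have h : 0 ≤ defectOp P := CFC.sqrt_nonneg _
  exact ((nonneg_iff_isPositive (defectOp P)).1 h).isSelfAdjoint

theorem defectOp_defectOp {P : H →L[ℂ] H} (hP : ‖P‖ ≤ 1) (x : H) :
    defectOp P (defectOp P x) = x - adjoint P (P x) := by
  have hpos : 0 ≤ 1 - adjoint P * P := by
    rw [nonneg_iff_isPositive, isPositive_def]
    refine ⟨?_, fun x => ?_⟩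
    · rw [← isSelfAdjoint_iff_isSymmetric, isSelfAdjoint_iff, star_sub, star_one,
        star_mul, star_eq_adjoint, star_eq_adjoint,
        adjoint_adjoint]
    · have h1 : inner ℂ ((1 - adjoint P * P) x) x = ((‖x‖ ^ 2 - ‖P x‖ ^ 2 : ℝ) : ℂ) := by
        change inner ℂ (x - adjoint P (P x)) x = _
        rw [inner_sub_left, adjoint_inner_left, inner_self_eq_norm_sq_to_K,
          inner_self_eq_norm_sq_to_K]
        push_cast
        rfl
      rw [reApplyInnerSelf_apply, h1, RCLike.re_to_complex, Complex.ofReal_re, sub_nonneg]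
      exact pow_le_pow_left₀ (norm_nonneg _)
        ((le_opNorm P x).trans (mul_le_of_le_one_left (norm_nonneg _) hP)) 2
  exact DFunLike.congr_fun (CFC.sqrt_mul_sqrt_self _ hpos) x

theorem norm_defectOp_sq {P : H →L[ℂ] H} (hP : ‖P‖ ≤ 1) (x : H) :
    ‖defectOp P x‖ ^ 2 = ‖x‖ ^ 2 - ‖P x‖ ^ 2 := by
  have h1 : inner ℂ (defectOp P x) (defectOp P x) = inner ℂ x x - inner ℂ (P x) (P x) := by
    rw [← adjoint_inner_right, adjoint_defectOp, defectOp_defectOp hP, inner_sub_right,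
      adjoint_inner_right]
  rw [inner_self_eq_norm_sq_to_K, inner_self_eq_norm_sq_to_K, inner_self_eq_norm_sq_to_K] at h1
  exact_mod_cast h1

/-- The defect operator as a map into the defect space. -/
def defectMap (P : H →L[ℂ] H) : H →L[ℂ] defectSpace P :=
  (defectOp P).codRestrict _ (defectOp_mem P)

@[simp] theorem coe_defectMap (P : H →L[ℂ] H) (x : H) :
    (defectMap P x : H) = defectOp P x := rfl

theorem denseRange_defectMap (P : H →L[ℂ] H) : DenseRange (defectMap P) := by
  rintro ⟨y, hy⟩
  have hy' : y ∈ closure (Set.range (defectOp P)) := hy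
  rw [closure_subtype]
  convert hy' using 2
  ext z
  simp only [Set.mem_image, Set.mem_range, exists_exists_eq_and, coe_defectMap]

theorem eq_zero_of_defectOp_eq_zero {P : H →L[ℂ] H} {y : defectSpace P}
    (hy : defectOp P y = 0) : y = 0 := by
  refine (denseRange_defectMap P).eq_zero_of_inner_left ℂ fun x => ?_
  rw [Submodule.coe_inner, coe_defectMap, ← adjoint_inner_left, adjoint_defectOp, hy,
    inner_zero_left]

theorem IsFundamentalOperator.norm_inner_le {S P : H →L[ℂ] H} (h : IsGammaContraction S P)
    {F : defectSpace (adjoint P) →L[ℂ] defectSpace (adjoint P)}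
    (hF : IsFundamentalOperator (adjoint S) (adjoint P) F) (v : defectSpace (adjoint P)) :
    ‖inner ℂ v (F v)‖ ≤ ‖v‖ ^ 2 := by
  have hP : ‖adjoint P‖ ≤ 1 := by rw [LinearIsometryEquiv.norm_map]; exact h.norm_snd_le
  refine (denseRange_defectMap (adjoint P)).induction_on v
    (isClosed_le (by fun_prop) (by fun_prop)) fun x => ?_
  have hinner : inner ℂ (defectMap (adjoint P) x) (F (defectMap (adjoint P) x)) =
      inner ℂ x (adjoint S x - S (adjoint P x)) := by
    have h1 := hF x
    rw [adjoint_adjoint] at h1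
    rw [h1, Submodule.coe_inner, coe_defectMap, ← adjoint_inner_right, adjoint_defectOp]
    rfl
  have hnorm : ‖defectMap (adjoint P) x‖ ^ 2 = ‖x‖ ^ 2 - ‖adjoint P x‖ ^ 2 :=
    norm_defectOp_sq hP x
  rw [hinner, hnorm]
  set c := inner ℂ x (adjoint S x - S (adjoint P x)) with hc
  rcases eq_or_ne c 0 with h0 | h0
  · rw [h0, norm_zero, ← hnorm]
    exact sq_nonneg _
  · have hα : ‖((‖c‖ : ℂ) / c)‖ = 1 := by
      rw [norm_div, Complex.norm_real, norm_norm, div_self (norm_ne_zero_iff.2 h0)]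
    have := h.re_inner_le hα x
    rwa [← hc, div_mul_cancel₀ _ h0, Complex.ofReal_re] at this

/-- The intertwining relation `D S* = F D + F* D P*` with `D = D_{P*}`. After applying `D`, which
is injective on `𝒟_{P*}`, it follows from the equations for `F` and `F*`. -/
theorem IsFundamentalOperator.defectMap_apply {S P : H →L[ℂ] H} (h : IsGammaContraction S P)
    {F : defectSpace (adjoint P) →L[ℂ] defectSpace (adjoint P)}
    (hF : IsFundamentalOperator (adjoint S) (adjoint P) F) (x : H) :
    defectMap (adjoint P) (adjoint S x) =
      F (defectMap (adjoint P) x) + star F (defectMap (adjoint P) (adjoint P x)) := by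
  have hP : ‖adjoint P‖ ≤ 1 := by rw [LinearIsometryEquiv.norm_map]; exact h.norm_snd_le
  have hF1 (x : H) : defectOp (adjoint P) (F (defectMap (adjoint P) x)) =
      adjoint S x - S (adjoint P x) := by
    have := hF x
    rw [adjoint_adjoint] at this
    exact this.symm
  have hF2 (x : H) : defectOp (adjoint P) (star F (defectMap (adjoint P) x)) =
      S x - P (adjoint S x) := by
    refine ext_inner_right ℂ fun w => ?_
    have e (a b : defectSpace (adjoint P)) : inner ℂ (a : H) (b : H) = inner ℂ a b := rfl
    rw [← adjoint_inner_right, adjoint_defectOp, ← coe_defectMap, e, star_eq_adjoint,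
      adjoint_inner_left, ← e, coe_defectMap, ← adjoint_inner_right, adjoint_defectOp, hF1,
      inner_sub_right, inner_sub_left, adjoint_inner_right, ← adjoint_inner_left S,
      adjoint_inner_right P]
  have hc : adjoint S (adjoint P x) = adjoint P (adjoint S x) :=
    DFunLike.congr_fun h.commute.star_star.eq x
  rw [← sub_eq_zero]
  refine eq_zero_of_defectOp_eq_zero ?_
  rw [Submodule.coe_sub, Submodule.coe_add, map_sub, map_add, hF1, hF2, coe_defectMap,
    defectOp_defectOp hP, adjoint_adjoint, hc]
  abel

/-- Purity makes the observability map `x ↦ (D_{P*} P*ⁿ x)ₙ` injective. -/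
theorem eq_zero_of_defectOp_pow_eq_zero {T : H →L[ℂ] H} (hT : ‖T‖ ≤ 1) {y : H}
    (hpure : Filter.Tendsto (fun n : ℕ => (T ^ n) y) Filter.atTop (𝓝 0))
    (h : ∀ n, defectOp T ((T ^ n) y) = 0) : y = 0 := by
  have hn (n : ℕ) : ‖(T ^ n) y‖ = ‖y‖ := by
    induction n with
    | zero => simp
    | succ n ih =>
      have h1 := norm_defectOp_sq hT ((T ^ n) y)
      rw [h n, norm_zero, zero_pow two_ne_zero, eq_comm, sub_eq_zero] at h1
      have h2 : (T ^ (n + 1)) y = T ((T ^ n) y) := by rw [pow_succ']; rfl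
      rw [h2, ← ih]
      exact ((pow_left_inj₀ (norm_nonneg _) (norm_nonneg _) two_ne_zero).1 h1).symm
  have h3 := hpure.norm
  simp only [hn, norm_zero] at h3
  exact norm_eq_zero.1 (tendsto_nhds_unique tendsto_const_nhds h3)

theorem polyCalc_pencilPoly_adjoint_eq_zero {S P : H →L[ℂ] H} (h : IsPureGammaContraction S P)
    [FiniteDimensional ℂ (defectSpace (adjoint P))]
    {F : defectSpace (adjoint P) →L[ℂ] defectSpace (adjoint P)}
    (hF : IsFundamentalOperator (adjoint S) (adjoint P) F) :
    polyCalc (adjoint S) (adjoint P) (pencilPoly F (star F)) = 0 := by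
  have hc : Commute (adjoint S) (adjoint P) := h.1.commute.star_star
  have hP : ‖adjoint P‖ ≤ 1 := by rw [LinearIsometryEquiv.norm_map]; exact h.1.norm_snd_le
  ext x
  refine eq_zero_of_defectOp_pow_eq_zero hP (h.2 _) fun n => ?_
  have hcomm : (adjoint P ^ n) (polyCalc (adjoint S) (adjoint P) (pencilPoly F (star F)) x) =
      polyCalc (adjoint S) (adjoint P) (pencilPoly F (star F)) ((adjoint P ^ n) x) := by
    have h1 : adjoint P ^ n = polyCalcHom hc (MvPolynomial.X 1 ^ n) := by simp
    rw [← polyCalcHom_apply hc, h1]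
    change (_ * _ : H →L[ℂ] H) x = (_ * _ : H →L[ℂ] H) x
    rw [← map_mul, mul_comm, map_mul]
  rw [hcomm, ← coe_defectMap, comp_polyCalc_pencilPoly hc (hF.defectMap_apply h.1)]
  rfl

end GammaContraction

end SymBidisc

end

theorem theorem5p9 {H : Type*} [NormedAddCommGroup H] [InnerProductSpace ℂ H] [CompleteSpace H]
    (S P : H →L[ℂ] H) (hSP : SymBidisc.IsPureGammaContraction S P)
    (hfin : FiniteDimensional ℂ (SymBidisc.defectSpace (ContinuousLinearMap.adjoint P)))
    (F : SymBidisc.defectSpace (ContinuousLinearMap.adjoint P) →L[ℂ]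
      SymBidisc.defectSpace (ContinuousLinearMap.adjoint P))
    (hF : SymBidisc.IsFundamentalOperator (ContinuousLinearMap.adjoint S)
      (ContinuousLinearMap.adjoint P) F) :
    (SymBidisc.IsGammaDistinguished F 0 ↔ spectralRadius ℂ F < 1) ∧
      (SymBidisc.IsGammaDistinguished F 0 ∨ spectralRadius ℂ F < 1 →
        SymBidisc.IsGammaDistinguished S P) := by
  open SymBidisc ContinuousLinearMap in
  have hw := hF.norm_inner_le hSP.1
  have hiff := isGammaDistinguished_zero_iff hw
  refine ⟨hiff, fun h => ?_⟩
  have hr := spectralRadius_lt_one_iff.1 (h.elim hiff.1 id)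
  have hc := hSP.1.commute
  -- The pencil annihilates `(S*, P*)`, hence its coefficientwise conjugate annihilates `(S, P)`.
  -- The zeros of the conjugate are governed by `F*` in place of `F`.
  have h0 : polyCalc S P (MvPolynomial.map (starRingEnd ℂ) (pencilPoly F (star F))) = 0 := by
    have h1 := adjoint_polyCalc (S := adjoint S) (P := adjoint P) hc.star_star
      (pencilPoly F (star F))
    rw [polyCalc_pencilPoly_adjoint_eq_zero hSP hF, star_zero, star_eq_adjoint, star_eq_adjoint,
      adjoint_adjoint, adjoint_adjoint] at h1
    exact h1.symm
  refine ⟨hSP.1, MvPolynomial.X 0 * MvPolynomial.map (starRingEnd ℂ) (pencilPoly F (star F)),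
    isGammaDistinguishedPoly_X_mul (F := star F) (norm_inner_star_le hw) ?_ ?_, ?_⟩
  · intro l hl
    rw [spectrum.map_star, Set.mem_star] at hl
    simpa using hr _ hl
  · intro z hz hu
    rw [polyVal_map_conj, map_eq_zero, polyVal_pencilPoly_eq_zero_iff] at hz
    refine hz ?_
    have := hu.star
    simpa using this
  · rw [← polyCalcHom_apply hc, map_mul, polyCalcHom_apply, polyCalcHom_apply, h0, mul_zero]
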